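/- Consider RLNC gossip over $\mathbb{F}_2$ ($q=2$) in the synchronous random phone call PULL model: there are $n$ nodes and $k$ messages, and each node $u$ maintains a subspace $Y_u\subseteq\mathbb{F}_2^k$, initially spanned by the standard basis vectors $e_i$ of the messages $i$ it holds. In each round, every node $v$ independently draws a packet $c_v$ uniformly from $Y_v$, every node $u$ independently chooses a uniformly random other node $p(u)\neq u$, and then $Y_u$ is replaced by $Y_u+\langle c_{p(u)}\rangle$. The gossip has finished once $Y_u=\mathbb{F}_2^k$ for all nodes $u$ (so that every node can decode all messages). Let $k=k(n)$ satisfy $k/\log n\to\infty$; for example, $k\ge\log^{1+\delta(n)}n$ with $\delta(n)\to 0$ and $(\log n)^{\delta(n)}\to\infty$. If the $k$ messages are initially held by $k$ distinct nodes, one message each and each message at one node, then RLNC gossip finishes with high probability within $(1+o(1))k$ rounds. That is, for all $\varepsilon>0$ and $a>0$ there is an $N$ such that for every $n\ge N$, every such initial placement on $n$ nodes and every integer $t\ge(1+\varepsilon)k$, the probability that the gossip has finished after $t$ rounds is at least $1-n^{-a}$. -/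

import Mathlib

open Filter Topology

namespace RLNC

/-- The uniform distribution on a nonempty finite type. -/
noncomputable def uniform (α : Type*) [Finite α] [Nonempty α] : PMF α :=
  letI := Fintype.ofFinite α
  PMF.uniformOfFintype α

/-- A network state assigns to every node `u : V` the subspace `Y u` of `F ^ k` spanned by the
coefficient vectors of the packets that `u` knows. -/
abbrev State (F V : Type*) [Field F] (k : ℕ) : Type _ :=
  V → Submodule F (Fin k → F)

/-- The choice, for every node, of another node to pull from. -/
abbrev Pull (V : Type*) : Type _ := ∀ u : V, {v : V // v ≠ u}

instance {V : Type*} [Nontrivial V] : Nonempty (Pull V) :=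
  ⟨fun u => ⟨(exists_ne u).choose, (exists_ne u).choose_spec⟩⟩

/-- The choice, for every node `v`, of a packet (its coefficient vector) from the span of
what `v` knows. -/
abbrev Packets {F V : Type*} [Field F] {k : ℕ} (Y : State F V k) : Type _ := ∀ v : V, Y v

/-- Initial state, when message `i` is known to the node `init i` only: the subspace of node `u`
is spanned by the standard basis vectors of the messages that `u` holds. -/
def initialState (F : Type*) {V : Type*} [Field F] {k : ℕ} (init : Fin k → V) : State F V k :=
  fun u => Submodule.span F {c | ∃ i, init i = u ∧ c = Pi.single i 1}

/-- The state after a round in which node `u` receives the packet of the node `p u`. -/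
def receive {F V : Type*} [Field F] {k : ℕ} (Y : State F V k) (p : Pull V) (c : Packets Y) :
    State F V k :=
  fun u => Y u ⊔ Submodule.span F {(c (p u).1 : Fin k → F)}

/-- One synchronous round of RLNC gossip in the random phone call PULL model on the nodes `V`:
every node chooses a uniformly random other node to pull from and a uniformly random packet
from its own subspace, all these choices being independent; every node then
receives the packet of the node that it pulls from. -/
noncomputable def pullRound {F V : Type*} [Field F] [Finite F] [Finite V] [Nontrivial V] {k : ℕ}
    (Y : State F V k) : PMF (State F V k) :=
  (uniform (Pull V)).bind fun p => (uniform (Packets Y)).map fun c => receive Y p c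

/-- The distribution of the network state after `t` rounds. -/
noncomputable def stateAfter (F : Type*) {V : Type*} [Field F] [Finite F] [Finite V]
    [Nontrivial V] {k : ℕ} (init : Fin k → V) : ℕ → PMF (State F V k)
  | 0 => PMF.pure (initialState F init)
  | t + 1 => (stateAfter F init t).bind pullRound

/-- The probability that after `t` rounds every node can decode all messages, that is, that
every node's coefficient subspace is the whole space. -/
noncomputable def probFinished (F : Type*) {V : Type*} [Field F] [Finite F] [Finite V]
    [Nontrivial V] {k : ℕ} (init : Fin k → V) (t : ℕ) : ℝ :=
  ((stateAfter F init t).toOuterMeasure {Y | ∀ u, Y u = ⊤}).toReal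

end RLNC

/-!
Call a vector `μ ≠ 0` of `𝔽₂ ^ k` *known* to a node if the node's subspace is not orthogonal to `μ`.
A node can decode everything if and only if it knows every `μ ≠ 0`, so the failure probability is at
most the sum over all nodes `u` and all `μ ≠ 0` of the probability that `u` does not know `μ` after
`t` rounds. For a fixed `μ`, the set of nodes that know it evolves autonomously: each such node
emits a packet that is not orthogonal to `μ` with probability `1 / 2`, and whoever pulls such a
packet comes to know `μ`.

Once all but a proportion `η` of the nodes know `μ`, any other node fails to learn it in a round
with probability at most `(1 + η) / 2`. Up to that time the number `x` of nodes that know `μ` grows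
in each round by the factor `1 + η / 4`, except with probability `12 / (12 + η ^ 2 * x)`, by
Cantelli's inequality (`expect_slow_growth`). Both regimes are combined in one potential, the
indicator that `u` does not know `μ` plus a multiple of `(n / x) ^ m` while `x < (1 - η) * n`, whose
expectation shrinks geometrically; this gives `mean_notMem_knowers_le`, with a prefactor that is
polynomial in `n`.

The rate of decay depends on `x`. While `x` is small it is only some constant `σ < 1`, which does
not make up for `2 ^ k` vectors. But when the messages start at distinct nodes, `x` is at
the start at least the Hamming weight of `μ`. If the weight is at least a constant `W`, the rate is
`(1 + η) / 2`, and `2 ^ k * ((1 + η) / 2) ^ ((1 + ε) * k)` is exponentially small in `k`. The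
vectors of weight less than `W` are so few (at most `z ^ (-W) * (1 + z) ^ k` for every `0 < z ≤ 1`)
that the rate `σ` suffices for them. Since `k / log n → ∞`, a bound that is exponentially small in
`k` outweighs any power of `n`.
-/

namespace RLNC

open scoped BigOperators ENNReal Matrix


/-! ### Moments of sums of independent indicators -/

theorem expect_pi_prod {ι : Type*} [Fintype ι] [DecidableEq ι] {α : ι → Type*}
    [∀ i, Fintype (α i)] (g : ∀ i, α i → ℝ) :
    𝔼 p : ∀ i, α i, ∏ i, g i (p i) = ∏ i, 𝔼 a, g i a := by
  simp only [Fintype.expect_eq_sum_div_card, Finset.prod_div_distrib, Fintype.card_pi,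
    Nat.cast_prod, Finset.prod_univ_sum, Fintype.piFinset_univ]

theorem expect_pi_apply {ι : Type*} [Fintype ι] [DecidableEq ι] {α : ι → Type*}
    [∀ i, Fintype (α i)] [∀ i, Nonempty (α i)] (i : ι) (f : α i → ℝ) :
    𝔼 p : ∀ i, α i, f (p i) = 𝔼 a, f a := by
  have h := expect_pi_prod (α := α) (Function.update (fun _ _ => 1) i f)
  rw [Fintype.prod_eq_single i (fun j hj => by simp [Function.update_of_ne hj])] at h
  simp only [Function.update_self] at h
  rw [← h]
  refine Finset.expect_congr rfl fun p _ => ?_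
  rw [Fintype.prod_eq_single i (fun j hj => by simp [Function.update_of_ne hj])]
  simp

theorem expect_pi_mul {ι : Type*} [Fintype ι] [DecidableEq ι] {α : ι → Type*}
    [∀ i, Fintype (α i)] [∀ i, Nonempty (α i)] {i j : ι} (hij : i ≠ j) (f : α i → ℝ)
    (g : α j → ℝ) :
    𝔼 p : ∀ i, α i, f (p i) * g (p j) = (𝔼 a, f a) * 𝔼 a, g a := by
  have h := expect_pi_prod (α := α) (Function.update (Function.update (fun _ _ => 1) j g) i f)
  rw [Fintype.prod_eq_mul i j hij (fun l hl => by
    simp [Function.update_of_ne hl.1, Function.update_of_ne hl.2])] at h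
  simp only [Function.update_self, Function.update_of_ne hij.symm] at h
  rw [← h]
  refine Finset.expect_congr rfl fun p _ => ?_
  rw [Fintype.prod_eq_mul i j hij (fun l hl => by
    simp [Function.update_of_ne hl.1, Function.update_of_ne hl.2])]
  simp [Function.update_of_ne hij.symm]

theorem expect_pi_sum {ι : Type*} [Fintype ι] [DecidableEq ι] {α : ι → Type*}
    [∀ i, Fintype (α i)] [∀ i, Nonempty (α i)] (s : Finset ι) (g : ∀ i, α i → ℝ) :
    𝔼 p : ∀ i, α i, ∑ i ∈ s, g i (p i) = ∑ i ∈ s, 𝔼 a, g i a := by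
  rw [Finset.expect_sum_comm]
  exact Finset.sum_congr rfl fun i _ => expect_pi_apply i (g i)

/-- The second moment of a sum of independent indicators. -/
theorem expect_pi_sum_sq {ι : Type*} [Fintype ι] [DecidableEq ι] {α : ι → Type*}
    [∀ i, Fintype (α i)] [∀ i, Nonempty (α i)] (s : Finset ι) (g : ∀ i, α i → ℝ)
    (hg : ∀ i a, g i a * g i a = g i a) :
    𝔼 p : ∀ i, α i, (∑ i ∈ s, g i (p i)) ^ 2 =
      (∑ i ∈ s, 𝔼 a, g i a) ^ 2 + ∑ i ∈ s, ((𝔼 a, g i a) - (𝔼 a, g i a) ^ 2) := by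
  have key : ∀ i j, 𝔼 p : ∀ i, α i, g i (p i) * g j (p j) =
      (𝔼 a, g i a) * (𝔼 a, g j a) +
        if i = j then (𝔼 a, g i a) - (𝔼 a, g i a) ^ 2 else 0 := by
    intro i j
    by_cases hij : i = j
    · subst hij
      simp only [hg, expect_pi_apply, if_true]
      ring
    · simp [expect_pi_mul hij, hij]
  simp only [sq (Finset.sum s _), Finset.sum_mul_sum]
  rw [Finset.expect_sum_comm, ← Finset.sum_add_distrib]
  refine Finset.sum_congr rfl fun i hi => ?_
  rw [Finset.expect_sum_comm]
  simp only [key, Finset.sum_add_distrib, Finset.sum_ite_eq, hi, if_true]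

/-- Cantelli's one-sided Chebyshev inequality, for a uniform average. -/
theorem expect_cantelli {Ω : Type*} [Fintype Ω] [Nonempty Ω] (X : Ω → ℝ) {M v l : ℝ} (hv : 0 ≤ v)
    (hl : 0 < l) (h1 : 𝔼 w, X w = M) (h2 : 𝔼 w, X w ^ 2 ≤ M ^ 2 + v) :
    𝔼 w, (if X w < M - l then (1 : ℝ) else 0) ≤ v / (v + l ^ 2) := by
  -- The shift `v / l` is the one that optimises the resulting bound.
  set τ := v / l with hτ
  have hτ0 : 0 ≤ τ := by positivity
  have hd : 0 < l + τ := by positivity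
  have hp : ∀ w, (if X w < M - l then (1 : ℝ) else 0) ≤
      ((l + τ) ^ 2)⁻¹ * (X w ^ 2 + (-(2 * (M + τ))) * X w + (M + τ) ^ 2) := by
    intro w
    have e : X w ^ 2 + (-(2 * (M + τ))) * X w + (M + τ) ^ 2 = (M + τ - X w) ^ 2 := by ring
    rw [e]
    split_ifs with h
    · rw [inv_mul_eq_div, one_le_div (by positivity)]
      gcongr
      linarith
    · positivity
  calc _ ≤ 𝔼 w, ((l + τ) ^ 2)⁻¹ * (X w ^ 2 + (-(2 * (M + τ))) * X w + (M + τ) ^ 2) :=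
        Finset.expect_le_expect fun w _ => hp w
    _ = ((l + τ) ^ 2)⁻¹ * ((𝔼 w, X w ^ 2) + (-(2 * (M + τ))) * M + (M + τ) ^ 2) := by
        rw [← Finset.mul_expect, Finset.expect_add_distrib, Finset.expect_add_distrib,
          ← Finset.mul_expect, h1, Fintype.expect_const]
    _ ≤ ((l + τ) ^ 2)⁻¹ * (v + τ ^ 2) := by
        refine mul_le_mul_of_nonneg_left ?_ (by positivity)
        nlinarith
    _ = v / (v + l ^ 2) := by
        rw [hτ]
        have : 0 < v + l ^ 2 := by positivity
        field_simp
        ring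

/-! ### Means under discrete distributions -/

/-- The mean of a function with values in `ℝ≥0∞` under a discrete distribution. -/
noncomputable def mean {α : Type*} (p : PMF α) (f : α → ℝ≥0∞) : ℝ≥0∞ := ∑' a, p a * f a

theorem mean_mono_of_support {α : Type*} {p : PMF α} {f g : α → ℝ≥0∞}
    (h : ∀ a ∈ p.support, f a ≤ g a) : mean p f ≤ mean p g := by
  refine ENNReal.tsum_le_tsum fun a => ?_
  by_cases ha : p a = 0
  · simp [ha]
  · gcongr
    exact h a ((p.mem_support_iff a).2 ha)

theorem mean_const_mul {α : Type*} (p : PMF α) (c : ℝ≥0∞) (f : α → ℝ≥0∞) :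
    mean p (fun a => c * f a) = c * mean p f := by
  simp only [mean, ← ENNReal.tsum_mul_left]
  exact tsum_congr fun a => by ring

theorem mean_finset_sum {α ι : Type*} (p : PMF α) (s : Finset ι) (f : ι → α → ℝ≥0∞) :
    mean p (fun a => ∑ i ∈ s, f i a) = ∑ i ∈ s, mean p (f i) := by
  simp only [mean, Finset.mul_sum]
  exact Summable.tsum_finsetSum fun _ _ => ENNReal.summable

theorem mean_pure {α : Type*} (a : α) (f : α → ℝ≥0∞) : mean (PMF.pure a) f = f a := by
  classical
  rw [mean, tsum_eq_single a fun b hb => by simp [PMF.pure_apply, hb]]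
  simp

theorem mean_bind {α β : Type*} (p : PMF α) (q : α → PMF β) (f : β → ℝ≥0∞) :
    mean (p.bind q) f = mean p fun a => mean (q a) f := by
  simp only [mean, PMF.bind_apply, ← ENNReal.tsum_mul_right, ← ENNReal.tsum_mul_left]
  rw [ENNReal.tsum_comm]
  exact tsum_congr fun a => tsum_congr fun b => by ring

theorem mean_map {α β : Type*} (p : PMF α) (g : α → β) (f : β → ℝ≥0∞) :
    mean (p.map g) f = mean p fun a => f (g a) := by
  simp only [PMF.map, mean_bind, Function.comp_def, mean_pure]

theorem mean_uniform {α : Type*} [Fintype α] [Nonempty α] {f : α → ℝ} (hf : ∀ a, 0 ≤ f a) :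
    mean (uniform α) (fun a => ENNReal.ofReal (f a)) = ENNReal.ofReal (𝔼 a, f a) := by
  have h : ∀ a, uniform α a = (Fintype.card α : ℝ≥0∞)⁻¹ := by
    intro a
    simp only [uniform, PMF.uniformOfFintype_apply, ← Nat.card_eq_fintype_card]
  rw [mean, tsum_fintype, Fintype.expect_eq_sum_div_card,
    ENNReal.ofReal_div_of_pos (by exact_mod_cast Fintype.card_pos),
    ENNReal.ofReal_sum_of_nonneg fun a _ => hf a, ENNReal.ofReal_natCast, div_eq_mul_inv,
    mul_comm, Finset.mul_sum]
  simp only [h]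

theorem toOuterMeasure_eq_mean {α : Type*} (p : PMF α) (s : Set α) :
    p.toOuterMeasure s = mean p (s.indicator 1) := by
  rw [PMF.toOuterMeasure_apply, mean]
  refine tsum_congr fun a => ?_
  by_cases h : a ∈ s <;> simp [h]

/-- The mean of a function of the state after one round, as an average over the choices. -/
theorem mean_pullRound {V : Type*} [Fintype V] [DecidableEq V] [Nontrivial V] {k : ℕ}
    (Y : State (ZMod 2) V k) [∀ v, Fintype (Y v)] {f : State (ZMod 2) V k → ℝ}
    (hf : ∀ Y, 0 ≤ f Y) :
    mean (pullRound Y) (fun Y' => ENNReal.ofReal (f Y')) =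
      ENNReal.ofReal (𝔼 p : Pull V, 𝔼 c : Packets Y, f (receive Y p c)) := by
  simp only [pullRound, mean_bind, mean_map]
  rw [← mean_uniform fun p => Finset.expect_nonneg fun c _ => hf _]
  simp only [mean_uniform fun c : Packets Y => hf (receive Y _ c)]

theorem mem_support_pullRound {V : Type*} [Finite V] [Nontrivial V] {k : ℕ}
    {Y Y' : State (ZMod 2) V k} (h : Y' ∈ (pullRound Y).support) : Y ≤ Y' := by
  simp only [pullRound, PMF.mem_support_bind_iff, PMF.mem_support_map_iff] at h
  obtain ⟨p, -, c, -, rfl⟩ := h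
  exact fun u => le_sup_left

/-! ### Growth of the set of nodes that know a vector -/

/-- The indicator of `y` not being orthogonal to `μ`. -/
noncomputable def detect {k : ℕ} (μ y : Fin k → ZMod 2) : ℝ := if μ ⬝ᵥ y = 0 then 0 else 1

theorem detect_mul_self {k : ℕ} (μ y : Fin k → ZMod 2) :
    detect μ y * detect μ y = detect μ y := by
  unfold detect; split_ifs <;> simp

theorem detect_nonneg {k : ℕ} (μ y : Fin k → ZMod 2) : 0 ≤ detect μ y := by
  unfold detect; split_ifs <;> simp

open Classical in
/-- The nodes that know `μ`: those whose subspace is not orthogonal to `μ`. -/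
noncomputable def knowers {V : Type*} [Fintype V] {k : ℕ} (μ : Fin k → ZMod 2)
    (Y : State (ZMod 2) V k) : Finset V :=
  Finset.univ.filter fun v => ∃ y ∈ Y v, μ ⬝ᵥ y ≠ 0

section
variable {V : Type*} [Fintype V] {k : ℕ} {μ : Fin k → ZMod 2} {Y Y' : State (ZMod 2) V k}

theorem mem_knowers {v : V} : v ∈ knowers μ Y ↔ ∃ y ∈ Y v, μ ⬝ᵥ y ≠ 0 := by
  simp [knowers]

theorem knowers_mono (h : Y ≤ Y') : knowers μ Y ⊆ knowers μ Y' := by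
  intro v hv
  obtain ⟨y, hy, h0⟩ := mem_knowers.1 hv
  exact mem_knowers.2 ⟨y, h v hy, h0⟩

theorem detect_eq_zero_of_notMem {v : V} (hv : v ∉ knowers μ Y) (y : Y v) :
    detect μ (y : Fin k → ZMod 2) = 0 := by
  rw [mem_knowers] at hv
  push Not at hv
  simp [detect, hv y y.2]

theorem mem_knowers_receive {p : Pull V} {c : Packets Y} {u : V} :
    u ∈ knowers μ (receive Y p c) ↔
      u ∈ knowers μ Y ∨ μ ⬝ᵥ (c (p u).1 : Fin k → ZMod 2) ≠ 0 := by
  simp only [mem_knowers, receive]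
  constructor
  · rintro ⟨y, hy, h0⟩
    obtain ⟨a, ha, b, hb, rfl⟩ := Submodule.mem_sup.1 hy
    obtain ⟨r, rfl⟩ := Submodule.mem_span_singleton.1 hb
    by_contra! h
    rw [dotProduct_add, dotProduct_smul, h.1 a ha, h.2] at h0
    simp at h0
  · rintro (⟨y, hy, h0⟩ | h0)
    · exact ⟨y, Submodule.mem_sup_left hy, h0⟩
    · exact ⟨_, Submodule.mem_sup_right (Submodule.mem_span_singleton_self _), h0⟩

/-- A uniform packet of a node that knows `μ` is orthogonal to `μ` with probability `1 / 2`. -/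
theorem expect_detect {v : V} [Fintype (Y v)] (hv : v ∈ knowers μ Y) :
    𝔼 y : Y v, detect μ (y : Fin k → ZMod 2) = 1 / 2 := by
  obtain ⟨z, hz, h0⟩ := mem_knowers.1 hv
  -- Translation by `z` exchanges the packets that are orthogonal to `μ` with the others.
  have h : 𝔼 y : Y v, detect μ (y : Fin k → ZMod 2) =
      𝔼 y : Y v, (1 - detect μ (y : Fin k → ZMod 2)) := by
    refine Fintype.expect_equiv (Equiv.addRight (⟨z, hz⟩ : Y v)) _ _ fun y => ?_
    have : ∀ a b : ZMod 2, b ≠ 0 → (a + b = 0 ↔ a ≠ 0) := by decide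
    simp only [detect, Equiv.coe_addRight, Submodule.coe_add, dotProduct_add, this _ _ h0]
    split_ifs <;> simp_all
  rw [Finset.expect_sub_distrib, Fintype.expect_const] at h
  linarith

variable [DecidableEq V]

/-- The number of nodes that come to know `μ` in a round. -/
noncomputable def newKnowers (μ : Fin k → ZMod 2) (Y : State (ZMod 2) V k)
    (w : Pull V × Packets Y) : ℝ :=
  ∑ u ∈ (knowers μ Y)ᶜ, detect μ (w.2 (w.1 u).1 : Fin k → ZMod 2)

theorem newKnowers_nonneg (w : Pull V × Packets Y) : 0 ≤ newKnowers μ Y w :=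
  Finset.sum_nonneg fun _ _ => detect_nonneg _ _

theorem card_knowers_receive (w : Pull V × Packets Y) :
    ((knowers μ (receive Y w.1 w.2)).card : ℝ) = (knowers μ Y).card + newKnowers μ Y w := by
  have : knowers μ (receive Y w.1 w.2) = knowers μ Y ∪
      (knowers μ Y)ᶜ.filter fun u => μ ⬝ᵥ (w.2 (w.1 u).1 : Fin k → ZMod 2) ≠ 0 := by
    ext u
    simp only [mem_knowers_receive, Finset.mem_union, Finset.mem_filter, Finset.mem_compl]
    tauto
  rw [this, Finset.card_union_of_disjoint, newKnowers, Finset.card_filter]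
  · simp [detect, ite_not]
  · rw [Finset.disjoint_left]
    intro u hu h
    simp [hu] at h

/-- The mean of `β` over the nodes other than `u`, when `β u = 0`. -/
theorem expect_ne {u : V} {β : V → ℝ} (hβ : β u = 0) :
    𝔼 v : {v : V // v ≠ u}, β v = (∑ v, β v) / (Fintype.card V - 1) := by
  rw [Fintype.expect_eq_sum_div_card, Fintype.card_subtype_compl, Fintype.card_subtype_eq,
    Nat.cast_sub (Fintype.card_pos_iff.2 ⟨u⟩), Nat.cast_one]
  congr 1
  rw [← Finset.add_sum_erase Finset.univ β (Finset.mem_univ u), hβ, zero_add]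
  exact (Finset.sum_subtype _ (fun v => by simp) β).symm

variable [∀ v, Fintype (Y v)]

theorem expect_sum_detect :
    𝔼 c : Packets Y, ∑ v, detect μ (c v : Fin k → ZMod 2) = (knowers μ Y).card / 2 := by
  rw [expect_pi_sum Finset.univ fun v (y : Y v) => detect μ (y : Fin k → ZMod 2),
    ← Finset.sum_add_sum_compl (knowers μ Y), Finset.sum_congr rfl fun v hv => expect_detect hv,
    Finset.sum_eq_zero (s := (knowers μ Y)ᶜ) fun v hv => by
      simp [detect_eq_zero_of_notMem (Finset.mem_compl.1 hv)]]
  simp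
  ring

theorem expect_sum_detect_sq :
    𝔼 c : Packets Y, (∑ v, detect μ (c v : Fin k → ZMod 2)) ^ 2 =
      ((knowers μ Y).card / 2) ^ 2 + (knowers μ Y).card / 4 := by
  rw [expect_pi_sum_sq Finset.univ (fun v (y : Y v) => detect μ (y : Fin k → ZMod 2))
    fun v y => detect_mul_self _ _]
  rw [← expect_pi_sum, expect_sum_detect, ← Finset.sum_add_sum_compl (knowers μ Y),
    Finset.sum_congr rfl fun v hv => by rw [expect_detect hv],
    Finset.sum_eq_zero (s := (knowers μ Y)ᶜ) fun v hv => by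
      simp [detect_eq_zero_of_notMem (Finset.mem_compl.1 hv)]]
  simp
  ring

variable [Nontrivial V]

instance nonempty_ne (u : V) : Nonempty {v : V // v ≠ u} :=
  let ⟨v, hv⟩ := exists_ne u
  ⟨⟨v, hv⟩⟩

/-- The probability that a node which does not know `μ` learns it in a round. -/
theorem expect_learn {u : V} (hu : u ∉ knowers μ Y) :
    𝔼 w : Pull V × Packets Y, detect μ (w.2 (w.1 u).1 : Fin k → ZMod 2) =
      (knowers μ Y).card / 2 / (Fintype.card V - 1) := by
  rw [← Finset.univ_product_univ, Finset.expect_product, Finset.expect_comm]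
  have (c : Packets Y) : 𝔼 p : Pull V, detect μ (c (p u).1 : Fin k → ZMod 2) =
      (∑ v, detect μ (c v : Fin k → ZMod 2)) / (Fintype.card V - 1) := by
    rw [expect_pi_apply (α := fun u : V => {v : V // v ≠ u}) u
      fun v => detect μ (c v.1 : Fin k → ZMod 2)]
    exact expect_ne (β := fun v => detect μ (c v : Fin k → ZMod 2))
      (detect_eq_zero_of_notMem hu _)
  simp only [this]
  rw [← Finset.expect_div, expect_sum_detect]

theorem expect_newKnowers :
    𝔼 w, newKnowers μ Y w = (Fintype.card V - (knowers μ Y).card) *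
      ((knowers μ Y).card / 2 / (Fintype.card V - 1)) := by
  simp only [newKnowers]
  rw [Finset.expect_sum_comm, Finset.sum_congr rfl fun u hu => expect_learn (Finset.mem_compl.1 hu),
    Finset.sum_const, Finset.card_compl, nsmul_eq_mul, Nat.cast_sub (Finset.card_le_univ _)]

theorem expect_newKnowers_sq :
    𝔼 w, newKnowers μ Y w ^ 2 ≤
      (𝔼 w, newKnowers μ Y w) ^ 2 +
        ((Fintype.card V - (knowers μ Y).card) / (Fintype.card V - 1)) ^ 2 *
          ((knowers μ Y).card / 4) + 𝔼 w, newKnowers μ Y w := by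
  have hn : (knowers μ Y).card ≤ (Fintype.card V : ℝ) := by exact_mod_cast Finset.card_le_univ _
  have hn1 : (1 : ℝ) < Fintype.card V := by exact_mod_cast Fintype.one_lt_card
  have key (c : Packets Y) : 𝔼 p : Pull V, newKnowers μ Y (p, c) ^ 2 ≤
      ((Fintype.card V - (knowers μ Y).card) / (Fintype.card V - 1)) ^ 2 *
        (∑ v, detect μ (c v : Fin k → ZMod 2)) ^ 2 +
      (Fintype.card V - (knowers μ Y).card) / (Fintype.card V - 1) *
        (∑ v, detect μ (c v : Fin k → ZMod 2)) := by
    simp only [newKnowers]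
    rw [expect_pi_sum_sq (α := fun u : V => {v : V // v ≠ u}) (knowers μ Y)ᶜ
      (fun u v => detect μ (c v.1 : Fin k → ZMod 2)) fun u v => detect_mul_self _ _]
    have e : ∀ u ∈ (knowers μ Y)ᶜ,
        𝔼 v : {v : V // v ≠ u}, detect μ (c v.1 : Fin k → ZMod 2) =
          (∑ v, detect μ (c v : Fin k → ZMod 2)) / (Fintype.card V - 1) := fun u hu =>
      expect_ne (β := fun v => detect μ (c v : Fin k → ZMod 2))
        (detect_eq_zero_of_notMem (Finset.mem_compl.1 hu) _)
    have e' : ∀ u ∈ (knowers μ Y)ᶜ,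
        (𝔼 v : {v : V // v ≠ u}, detect μ (c v.1 : Fin k → ZMod 2)) -
          (𝔼 v : {v : V // v ≠ u}, detect μ (c v.1 : Fin k → ZMod 2)) ^ 2 =
          (∑ v, detect μ (c v : Fin k → ZMod 2)) / (Fintype.card V - 1) -
            ((∑ v, detect μ (c v : Fin k → ZMod 2)) / (Fintype.card V - 1)) ^ 2 :=
      fun u hu => by rw [e u hu]
    rw [Finset.sum_congr rfl e, Finset.sum_congr rfl e', Finset.sum_const,
      Finset.sum_const, Finset.card_compl, nsmul_eq_mul, nsmul_eq_mul,
      Nat.cast_sub (Finset.card_le_univ _)]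
    generalize (∑ v, detect μ (c v : Fin k → ZMod 2)) = S
    have : 0 ≤ ((Fintype.card V : ℝ) - (knowers μ Y).card) * (S / (Fintype.card V - 1)) ^ 2 :=
      mul_nonneg (by linarith) (sq_nonneg _)
    have e2 : ((Fintype.card V - (knowers μ Y).card) / (Fintype.card V - 1)) ^ 2 * S ^ 2 =
      ((Fintype.card V - (knowers μ Y).card) * (S / (Fintype.card V - 1))) ^ 2 := by ring
    have e3 : (Fintype.card V - (knowers μ Y).card) / (Fintype.card V - 1) * S =
      (Fintype.card V - (knowers μ Y).card) * (S / (Fintype.card V - 1)) := by ring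
    rw [e2, e3]
    linarith
  calc 𝔼 w, newKnowers μ Y w ^ 2
      = 𝔼 c : Packets Y, 𝔼 p : Pull V, newKnowers μ Y (p, c) ^ 2 := by
        rw [← Finset.univ_product_univ, Finset.expect_product, Finset.expect_comm]
    _ ≤ _ := Finset.expect_le_expect fun c _ => key c
    _ = _ := by
        rw [Finset.expect_add_distrib, ← Finset.mul_expect, ← Finset.mul_expect,
          expect_sum_detect, expect_sum_detect_sq, expect_newKnowers]
        ring

/-- As long as a proportion `η` of the nodes does not know `μ`, the number of the others grows in
a round by the factor `1 + η / 4`, with a probability that is bounded below and close to `1` when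
that number is large. -/
theorem expect_slow_growth {η : ℝ} (hη : 0 < η) (h1 : 1 ≤ (knowers μ Y).card)
    (hs : (knowers μ Y).card < (1 - η) * (Fintype.card V : ℝ)) :
    𝔼 w, (if newKnowers μ Y w < η / 4 * (knowers μ Y).card then (1 : ℝ) else 0) ≤
      12 / (12 + η ^ 2 * (knowers μ Y).card) := by
  have hn1 : (1 : ℝ) < Fintype.card V := by exact_mod_cast Fintype.one_lt_card
  have hx : (1 : ℝ) ≤ (knowers μ Y).card := by exact_mod_cast h1
  have hM := expect_newKnowers (μ := μ) (Y := Y)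
  have hM2 := expect_newKnowers_sq (μ := μ) (Y := Y)
  set x : ℝ := ((knowers μ Y).card : ℝ)
  set n : ℝ := (Fintype.card V : ℝ)
  set M := 𝔼 w, newKnowers μ Y w with hMdef
  set d := (n - x) / (n - 1) with hd
  have hMd : M = d * (x / 2) := by rw [hM, hd]; ring
  have hd1 : d ≤ 1 := by rw [hd, div_le_one (by linarith)]; linarith
  have hdη : η ≤ d := by rw [hd, le_div_iff₀ (by linarith)]; nlinarith
  have hl : 0 < η * x / 4 := by positivity
  have hvar : 𝔼 w, newKnowers μ Y w ^ 2 ≤ M ^ 2 + 3 / 4 * x := by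
    have a1 : d ^ 2 * (x / 4) ≤ x / 4 :=
      mul_le_of_le_one_left (by linarith) (pow_le_one₀ (hη.le.trans hdη) hd1)
    have a2 : d * (x / 2) ≤ x / 2 := mul_le_of_le_one_left (by linarith) hd1
    linarith
  have hv := expect_cantelli (newKnowers μ Y) (M := M) (v := 3 / 4 * x) (l := η * x / 4)
    (by linarith) hl rfl hvar
  have e : 3 / 4 * x / (3 / 4 * x + (η * x / 4) ^ 2) = 12 / (12 + η ^ 2 * x) := by
    field_simp
    ring
  rw [← e]
  refine le_trans (Finset.expect_le_expect fun w _ => ?_) hv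
  have : η / 4 * x ≤ M - η * x / 4 := by rw [hMd]; nlinarith
  split_ifs with ha hb
  · exact le_rfl
  · exact absurd (lt_of_lt_of_le ha this) hb
  · exact zero_le_one
  · exact le_rfl

end

/-! ### The potential -/

section
variable {V : Type*} [Fintype V]

/-- The part of the potential that controls the spreading phase: it is positive as long as a
proportion `η` of all nodes lies outside of `A`, and decreasing in the size of `A`. -/
noncomputable def spreadPotential (η : ℝ) (m : ℕ) (A : Finset V) : ℝ :=
  if (A.card : ℝ) < (1 - η) * Fintype.card V then ((Fintype.card V : ℝ) / A.card) ^ m else 0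

open Classical in
/-- The potential that bounds the probability that `u` never comes to know a vector which at
present is known to the nodes in `A`. -/
noncomputable def potential (η K : ℝ) (m : ℕ) (u : V) (A : Finset V) : ℝ :=
  (if u ∈ A then 0 else 1) + K * spreadPotential η m A

variable {η K : ℝ} {m : ℕ} {u : V} {A B : Finset V}

theorem spreadPotential_nonneg : 0 ≤ spreadPotential η m A := by
  unfold spreadPotential; split_ifs <;> positivity

theorem potential_nonneg (hK : 0 ≤ K) : 0 ≤ potential η K m u A := by
  have := mul_nonneg hK (spreadPotential_nonneg (η := η) (m := m) (A := A))
  unfold potential; split_ifs <;> linarith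

theorem spreadPotential_anti (hA : 1 ≤ A.card) (h : A ⊆ B) :
    spreadPotential η m B ≤ spreadPotential η m A := by
  have hc : (A.card : ℝ) ≤ B.card := by exact_mod_cast Finset.card_le_card h
  have hA' : (0 : ℝ) < A.card := by exact_mod_cast hA
  unfold spreadPotential
  split_ifs with h1 h2
  · gcongr
  · linarith
  · positivity
  · exact le_rfl

theorem spreadPotential_le_of_growth {r : ℝ} (hr : 0 < r) (hA : 1 ≤ A.card)
    (hs : (A.card : ℝ) < (1 - η) * Fintype.card V) (h : r * A.card ≤ B.card) :
    spreadPotential η m B ≤ (r ^ m)⁻¹ * spreadPotential η m A := by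
  have hA' : (0 : ℝ) < A.card := by exact_mod_cast hA
  rw [spreadPotential, spreadPotential, if_pos hs]
  split_ifs with h1
  · rw [← inv_pow, ← mul_pow]
    gcongr
    rw [← div_eq_inv_mul, div_div, mul_comm]
    gcongr
  · positivity

theorem spreadPotential_le (hA : 1 ≤ A.card) :
    spreadPotential η m A ≤ (Fintype.card V : ℝ) ^ m := by
  have hA' : (1 : ℝ) ≤ A.card := by exact_mod_cast hA
  unfold spreadPotential
  split_ifs
  · gcongr
    exact div_le_self (by positivity) hA'
  · positivity

theorem one_le_spreadPotential (hA : 1 ≤ A.card)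
    (hs : (A.card : ℝ) < (1 - η) * Fintype.card V) : 1 ≤ spreadPotential η m A := by
  have hA' : (0 : ℝ) < A.card := by exact_mod_cast hA
  rw [spreadPotential, if_pos hs]
  refine one_le_pow₀ ?_
  rw [one_le_div hA']
  exact_mod_cast Finset.card_le_univ A

end

theorem mem_support_stateAfter {V : Type*} [Finite V] [Nontrivial V] {k : ℕ}
    {Y : State (ZMod 2) V k} {init : Fin k → V} {t : ℕ}
    (h : Y ∈ (stateAfter (ZMod 2) init t).support) : initialState (ZMod 2) init ≤ Y := by
  induction t generalizing Y with
  | zero =>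
    simp only [stateAfter, PMF.support_pure, Set.mem_singleton_iff] at h
    exact h.ge
  | succ t ih =>
    simp only [stateAfter, PMF.mem_support_bind_iff] at h
    obtain ⟨X, hX, hY⟩ := h
    exact (ih hX).trans (mem_support_pullRound hY)

theorem card_support_le_card_knowers {V : Type*} [Fintype V] {k : ℕ} {μ : Fin k → ZMod 2}
    {init : Fin k → V} (hinit : Function.Injective init) :
    (Finset.univ.filter fun i => μ i ≠ 0).card ≤
      (knowers μ (initialState (ZMod 2) init)).card := by
  refine Finset.card_le_card_of_injOn init (fun i hi => ?_) hinit.injOn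
  refine mem_knowers.2 ⟨Pi.single i 1, Submodule.subset_span ⟨i, rfl, rfl⟩, ?_⟩
  simpa using hi

section
variable {V : Type*} [Fintype V] [DecidableEq V] [Nontrivial V] {k m : ℕ} {μ : Fin k → ZMod 2}
  {Y : State (ZMod 2) V k} {η K σ W : ℝ} {u : V}

/-- Once all but a proportion `η` of the nodes know `μ`, a node that does not know `μ` fails to
learn it in a round with probability at most `(1 + η) / 2`. -/
theorem expect_potential_of_large [∀ v, Fintype (Y v)] (hη : η < 1)
    (hσ : (1 + η) / 2 ≤ σ) (hs : (1 - η) * Fintype.card V ≤ (knowers μ Y).card) :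
    𝔼 w : Pull V × Packets Y, potential η K m u (knowers μ (receive Y w.1 w.2)) ≤
      σ * potential η K m u (knowers μ Y) := by
  have hn1 : (1 : ℝ) < Fintype.card V := by exact_mod_cast Fintype.one_lt_card
  have hs' : ∀ w : Pull V × Packets Y,
      (1 - η) * Fintype.card V ≤ (knowers μ (receive Y w.1 w.2)).card := fun w =>
    hs.trans (by rw [card_knowers_receive]; linarith [newKnowers_nonneg (μ := μ) w])
  have h0 : ∀ A : Finset V, (1 - η) * Fintype.card V ≤ A.card → spreadPotential η m A = 0 :=
    fun A hA => if_neg (not_lt.2 hA)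
  simp only [potential, h0 _ (hs' _), h0 _ hs, mul_zero, add_zero]
  by_cases hu : u ∈ knowers μ Y
  · simp [mem_knowers_receive, hu]
  · rw [Finset.expect_congr (g := fun w : Pull V × Packets Y =>
      1 - detect μ (w.2 (w.1 u).1 : Fin k → ZMod 2)) rfl fun w _ => by
        simp only [mem_knowers_receive, hu, false_or, detect]
        split_ifs <;> simp_all]
    rw [if_neg hu, mul_one, Finset.expect_sub_distrib, Fintype.expect_const, expect_learn hu]
    refine le_trans ?_ hσ
    have : (1 - η) / 2 ≤ (knowers μ Y).card / 2 / (Fintype.card V - 1 : ℝ) := by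
      rw [le_div_iff₀ (by linarith)]
      nlinarith
    linarith

/-- As long as a proportion `η` of the nodes does not know `μ`, the expected potential decreases
in a round, by a factor that depends on a lower bound `W` on the number of nodes knowing `μ`. -/
theorem expect_potential_of_small [∀ v, Fintype (Y v)] (hη : 0 < η) (hK : 0 < K)
    (hσ : 1 / K + ((1 + η / 4) ^ m)⁻¹ + 12 / (12 + η ^ 2 * W) ≤ σ) (hW : 1 ≤ W)
    (hY : W ≤ (knowers μ Y).card)
    (hs : (knowers μ Y).card < (1 - η) * (Fintype.card V : ℝ)) :
    𝔼 w : Pull V × Packets Y, potential η K m u (knowers μ (receive Y w.1 w.2)) ≤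
      σ * potential η K m u (knowers μ Y) := by
  have h1 : 1 ≤ (knowers μ Y).card := by exact_mod_cast hW.trans hY
  set T := spreadPotential η m (knowers μ Y) with hT
  have hT1 : 1 ≤ T := one_le_spreadPotential h1 hs
  have hp : ∀ w : Pull V × Packets Y,
      potential η K m u (knowers μ (receive Y w.1 w.2)) ≤ 1 + K * T * (((1 + η / 4) ^ m)⁻¹ +
        if newKnowers μ Y w < η / 4 * (knowers μ Y).card then (1 : ℝ) else 0) := by
    intro w
    have hle : spreadPotential η m (knowers μ (receive Y w.1 w.2)) ≤ T * (((1 + η / 4) ^ m)⁻¹ +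
        if newKnowers μ Y w < η / 4 * (knowers μ Y).card then (1 : ℝ) else 0) := by
      split_ifs with h
      · refine (spreadPotential_anti h1 (knowers_mono fun v => le_sup_left)).trans ?_
        rw [← hT, mul_add, mul_one]
        have : 0 ≤ T * ((1 + η / 4) ^ m)⁻¹ := by positivity
        linarith
      · rw [add_zero, mul_comm]
        refine spreadPotential_le_of_growth (by linarith) h1 hs ?_
        rw [card_knowers_receive]
        linarith
    have hK' := mul_le_mul_of_nonneg_left hle hK.le
    rw [mul_assoc]
    rw [potential]
    refine add_le_add ?_ hK'
    split_ifs <;> norm_num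
  have hg := expect_slow_growth hη h1 hs
  have hgW : 12 / (12 + η ^ 2 * (knowers μ Y).card) ≤ 12 / (12 + η ^ 2 * W) := by gcongr
  have hσ0 : 0 ≤ σ := le_trans (by positivity) hσ
  calc _ ≤ _ := Finset.expect_le_expect fun w _ => hp w
    _ = 1 + K * T * (((1 + η / 4) ^ m)⁻¹ + 𝔼 w,
          if newKnowers μ Y w < η / 4 * (knowers μ Y).card then (1 : ℝ) else 0) := by
        rw [Finset.expect_add_distrib, ← Finset.mul_expect, Finset.expect_add_distrib,
          Fintype.expect_const, Fintype.expect_const]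
    _ ≤ 1 + K * T * (σ - 1 / K) := by
        gcongr
        linarith
    _ = 1 - T + σ * (K * T) := by field_simp; ring
    _ ≤ σ * (K * T) := by linarith
    _ ≤ _ := by
        gcongr
        rw [potential, ← hT]
        split_ifs <;> linarith

/-- The potential is a supermartingale up to the factor `σ`, in both regimes. -/
theorem mean_pullRound_potential (hη : 0 < η) (hη1 : η < 1) (hK : 0 < K)
    (hσ : (1 + η) / 2 ≤ σ)
    (hσ' : 1 / K + ((1 + η / 4) ^ m)⁻¹ + 12 / (12 + η ^ 2 * W) ≤ σ) (hW : 1 ≤ W)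
    (hY : W ≤ (knowers μ Y).card) :
    mean (pullRound Y) (fun Y' => ENNReal.ofReal (potential η K m u (knowers μ Y'))) ≤
      ENNReal.ofReal σ * ENNReal.ofReal (potential η K m u (knowers μ Y)) := by
  classical
  have (v : V) : Fintype (Y v) := Fintype.ofFinite _
  rw [mean_pullRound Y fun _ => potential_nonneg hK.le, ← ENNReal.ofReal_mul (by linarith)]
  refine ENNReal.ofReal_le_ofReal ?_
  rw [← Finset.expect_product', Finset.univ_product_univ]
  rcases lt_or_ge ((knowers μ Y).card : ℝ) ((1 - η) * Fintype.card V) with hs | hs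
  · exact expect_potential_of_small hη hK hσ' hW hY hs
  · exact expect_potential_of_large hη1 hσ hs

open Classical in
/-- The probability that `u` does not know `μ` after `t` rounds decays geometrically, with a rate
that depends on the number of nodes that know `μ` at the start. -/
theorem mean_notMem_knowers_le (hη : 0 < η) (hη1 : η < 1) (hK : 0 < K)
    (hσ : (1 + η) / 2 ≤ σ)
    (hσ' : 1 / K + ((1 + η / 4) ^ m)⁻¹ + 12 / (12 + η ^ 2 * W) ≤ σ) (hW : 1 ≤ W)
    {init : Fin k → V} (hY : W ≤ (knowers μ (initialState (ZMod 2) init)).card) (t : ℕ) :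
    mean (stateAfter (ZMod 2) init t) (fun Y => if u ∈ knowers μ Y then 0 else 1) ≤
      ENNReal.ofReal (σ ^ t * (1 + K * (Fintype.card V : ℝ) ^ m)) := by
  have hind : mean (stateAfter (ZMod 2) init t)
        (fun Y => ENNReal.ofReal (potential η K m u (knowers μ Y))) ≤
      ENNReal.ofReal (σ ^ t) * ENNReal.ofReal
        (potential η K m u (knowers μ (initialState (ZMod 2) init))) := by
    induction t with
    | zero => simp [stateAfter, mean_pure]
    | succ t ih =>
      rw [stateAfter, mean_bind]
      refine (mean_mono_of_support fun Y hY' => mean_pullRound_potential hη hη1 hK hσ hσ' hW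
        (hY.trans ?_)).trans ?_
      · exact_mod_cast Finset.card_le_card (knowers_mono (mem_support_stateAfter hY'))
      · rw [mean_const_mul, pow_succ', ENNReal.ofReal_mul (by linarith), mul_assoc]
        gcongr
  have h1 : 1 ≤ (knowers μ (initialState (ZMod 2) init)).card := by exact_mod_cast hW.trans hY
  refine (mean_mono_of_support fun Y _ => ?_).trans (hind.trans ?_)
  · have := mul_nonneg hK.le (spreadPotential_nonneg (η := η) (m := m) (A := knowers μ Y))
    unfold potential
    split_ifs
    · exact zero_le
    · rw [← ENNReal.ofReal_one]
      exact ENNReal.ofReal_le_ofReal (by linarith)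
  · have hσ0 : 0 ≤ σ := by linarith
    rw [← ENNReal.ofReal_mul (by positivity)]
    refine ENNReal.ofReal_le_ofReal ?_
    gcongr
    unfold potential
    have := mul_le_mul_of_nonneg_left (spreadPotential_le (η := η) (m := m) h1) hK.le
    split_ifs <;> linarith

end

/-! ### Union bound over nodes and vectors -/

/-- A proper subspace of `F ^ k` is orthogonal to a nonzero vector. -/
theorem exists_dotProduct_eq_zero {F : Type*} [Field F] {k : ℕ} {S : Submodule F (Fin k → F)}
    (hS : S ≠ ⊤) : ∃ μ : Fin k → F, μ ≠ 0 ∧ ∀ y ∈ S, μ ⬝ᵥ y = 0 := by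
  obtain ⟨f, hf, hle⟩ := S.exists_le_ker_of_lt_top (lt_top_iff_ne_top.2 hS)
  have e : ∀ y, (fun i => f (Pi.single i 1)) ⬝ᵥ y = f y := fun y => by
    rw [LinearMap.pi_apply_eq_sum_univ f y]
    refine Finset.sum_congr rfl fun i _ => ?_
    rw [smul_eq_mul, mul_comm]
    refine congrArg (fun v => y i * f v) (funext fun j => ?_)
    simp [Pi.single_apply, eq_comm]
  refine ⟨fun i => f (Pi.single i 1), fun h => hf (LinearMap.ext fun y => ?_), fun y hy => ?_⟩
  · rw [← e, h, zero_dotProduct, LinearMap.zero_apply]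
  · rw [e]
    exact hle hy

open Classical in
/-- The union bound over all nodes and all nonzero vectors. -/
theorem one_sub_sum_le_probFinished {V : Type*} [Fintype V] [Nontrivial V] {k : ℕ}
    {init : Fin k → V} {t : ℕ} {b : (Fin k → ZMod 2) → ℝ} (hb : ∀ μ, 0 ≤ b μ)
    (h : ∀ (u : V) (μ : Fin k → ZMod 2), μ ≠ 0 →
      mean (stateAfter (ZMod 2) init t) (fun Y => if u ∈ knowers μ Y then 0 else 1) ≤
        ENNReal.ofReal (b μ)) :
    1 - Fintype.card V * ∑ μ, b μ ≤ probFinished (ZMod 2) init t := by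
  set p := stateAfter (ZMod 2) init t with hp
  set s : Set (State (ZMod 2) V k) := {Y | ∀ u, Y u = ⊤} with hs
  have hfail : mean p (sᶜ.indicator 1) ≤ ENNReal.ofReal (Fintype.card V * ∑ μ, b μ) := by
    have hpt : ∀ Y, sᶜ.indicator (1 : State (ZMod 2) V k → ℝ≥0∞) Y ≤
        ∑ u : V, ∑ μ : Fin k → ZMod 2, if μ = 0 then 0 else if u ∈ knowers μ Y then 0 else 1 := by
      intro Y
      by_cases hY : Y ∈ s
      · simp [hY]
      · rw [Set.indicator_of_mem (by exact hY)]
        simp only [hs, Set.mem_ofPred_eq, not_forall] at hY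
        obtain ⟨u, hu⟩ := hY
        obtain ⟨μ, h0, hμ⟩ := exists_dotProduct_eq_zero hu
        have hk : u ∉ knowers μ Y := by
          rw [mem_knowers]
          rintro ⟨y, hy, hne⟩
          exact hne (hμ y hy)
        calc (1 : ℝ≥0∞) = if μ = 0 then 0 else if u ∈ knowers μ Y then 0 else 1 := by
              rw [if_neg h0, if_neg hk]
          _ ≤ ∑ μ : Fin k → ZMod 2, if μ = 0 then 0 else if u ∈ knowers μ Y then 0 else 1 :=
              Finset.single_le_sum (f := fun μ : Fin k → ZMod 2 =>
                if μ = 0 then (0 : ℝ≥0∞) else if u ∈ knowers μ Y then 0 else 1)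
                (fun _ _ => zero_le) (Finset.mem_univ μ)
          _ ≤ _ := Finset.single_le_sum (f := fun u : V => ∑ μ : Fin k → ZMod 2,
                if μ = 0 then (0 : ℝ≥0∞) else if u ∈ knowers μ Y then 0 else 1)
                (fun _ _ => zero_le) (Finset.mem_univ u)
    refine (mean_mono_of_support fun Y _ => hpt Y).trans ?_
    simp only [mean_finset_sum]
    refine (Finset.sum_le_sum (g := fun _ : V => ENNReal.ofReal (∑ μ, b μ)) fun u _ => ?_).trans ?_
    · rw [ENNReal.ofReal_sum_of_nonneg fun μ _ => hb μ]
      refine Finset.sum_le_sum fun μ _ => ?_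
      by_cases h0 : μ = 0
      · simp [h0, mean]
      · simpa only [if_neg h0] using h u μ h0
    · rw [Finset.sum_const, nsmul_eq_mul, ENNReal.ofReal_mul (Nat.cast_nonneg _),
        ENNReal.ofReal_natCast]
      rfl
  have hsum : mean p (s.indicator 1) + mean p (sᶜ.indicator 1) = 1 := by
    rw [mean, mean, ← ENNReal.tsum_add, ← p.tsum_coe]
    refine tsum_congr fun Y => ?_
    by_cases hY : Y ∈ s <;> simp [hY]
  have hfin : mean p (s.indicator 1) ≠ ⊤ := fun h => by simp [h] at hsum
  have hb0 : 0 ≤ (Fintype.card V : ℝ) * ∑ μ, b μ :=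
    mul_nonneg (Nat.cast_nonneg _) (Finset.sum_nonneg fun μ _ => hb μ)
  have hle : (1 : ℝ≥0∞) ≤
      ENNReal.ofReal (probFinished (ZMod 2) init t + Fintype.card V * ∑ μ, b μ) := by
    have hP : 0 ≤ probFinished (ZMod 2) init t := ENNReal.toReal_nonneg
    rw [ENNReal.ofReal_add hP hb0, probFinished, toOuterMeasure_eq_mean,
      ENNReal.ofReal_toReal hfin, ← hsum]
    gcongr
  rw [ENNReal.one_le_ofReal] at hle
  linarith

/-- The generating function of the Hamming weights of the vectors over `𝔽₂`. -/
theorem sum_pow_card_support (k : ℕ) (z : ℝ) :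
    ∑ μ : Fin k → ZMod 2, z ^ (Finset.univ.filter fun i => μ i ≠ 0).card = (1 + z) ^ k := by
  have h := Finset.prod_univ_sum (fun _ : Fin k => (Finset.univ : Finset (ZMod 2)))
    (fun _ a => if a ≠ 0 then z else 1)
  have h2 : ∑ a : ZMod 2, (if a ≠ 0 then z else 1) = 1 + z := by
    rw [show (Finset.univ : Finset (ZMod 2)) = {0, 1} from rfl]
    simp
  rw [h2, Fintype.piFinset_univ, Finset.prod_const, Finset.card_univ, Fintype.card_fin] at h
  rw [h]
  refine Finset.sum_congr rfl fun μ _ => ?_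
  rw [Finset.prod_ite]
  simp

/-- The failure probability in terms of the parameters of the potential: vectors of weight at least
`W` contribute at rate `(1 + η) / 2`, those of smaller weight at rate `σ`. -/
theorem one_sub_le_probFinished {V : Type*} [Fintype V] [Nontrivial V] {k m W : ℕ}
    {η K σ z : ℝ} (hη : 0 < η) (hη1 : η < 1) (hK : 0 < K) (hσ : (1 + η) / 2 ≤ σ)
    (hσ' : 1 / K + ((1 + η / 4) ^ m)⁻¹ + 12 / (12 + η ^ 2) ≤ σ) (hW : 1 ≤ W)
    (hW' : 1 / K + ((1 + η / 4) ^ m)⁻¹ + 12 / (12 + η ^ 2 * W) ≤ (1 + η) / 2)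
    (hz : 0 < z) (hz1 : z ≤ 1) {init : Fin k → V} (hinit : Function.Injective init) (t : ℕ) :
    1 - Fintype.card V * ((1 + K * (Fintype.card V : ℝ) ^ m) *
        (2 ^ k * ((1 + η) / 2) ^ t + (z ^ W)⁻¹ * ((1 + z) ^ k * σ ^ t))) ≤
      probFinished (ZMod 2) init t := by
  classical
  have hσ0 : 0 ≤ σ := by linarith
  set wt : (Fin k → ZMod 2) → ℕ := fun μ => (Finset.univ.filter fun i => μ i ≠ 0).card with hwt
  set C := 1 + K * (Fintype.card V : ℝ) ^ m with hC
  have hC0 : 0 ≤ C := by positivity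
  have key := one_sub_sum_le_probFinished (init := init) (t := t)
    (b := fun μ => C * (((1 + η) / 2) ^ t + (z ^ W)⁻¹ * (z ^ wt μ * σ ^ t)))
    (fun μ => by positivity) fun u μ h0 => by
      have hk : (wt μ : ℝ) ≤ (knowers μ (initialState (ZMod 2) init)).card := by
        exact_mod_cast card_support_le_card_knowers hinit
      have h1 : (1 : ℝ) ≤ wt μ := by
        obtain ⟨i, hi⟩ := Function.ne_iff.1 h0
        exact_mod_cast Finset.card_pos.2 ⟨i, by simpa using hi⟩
      rcases le_or_gt W (wt μ) with hw | hw
      · refine (mean_notMem_knowers_le hη hη1 hK le_rfl hW' (by exact_mod_cast hW)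
          (le_trans (by exact_mod_cast hw) hk) t).trans (ENNReal.ofReal_le_ofReal ?_)
        rw [← hC, mul_comm]
        gcongr
        exact le_add_of_nonneg_right (by positivity)
      · refine (mean_notMem_knowers_le (W := 1) hη hη1 hK hσ (by simpa using hσ') le_rfl
          (h1.trans hk) t).trans (ENNReal.ofReal_le_ofReal ?_)
        rw [← hC, mul_comm]
        gcongr
        -- Vectors of weight less than `W` are counted by `z ^ (wt μ - W) ≥ 1`.
        have : 1 ≤ (z ^ W)⁻¹ * z ^ wt μ := by
          rw [inv_mul_eq_div, one_le_div (by positivity)]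
          exact pow_le_pow_of_le_one hz.le hz1 hw.le
        rw [← mul_assoc]
        refine (le_mul_of_one_le_left (by positivity) this).trans ?_
        exact le_add_of_nonneg_left (by positivity)
  refine le_of_eq_of_le ?_ key
  rw [← Finset.mul_sum, Finset.sum_add_distrib, ← Finset.mul_sum, ← Finset.sum_mul,
    sum_pow_card_support]
  simp

/-! ### Choice of parameters and asymptotics -/

/-- The parameters of the potential: `(1 + η) / 2` is the rate of decay for vectors of weight at
least `W`, and `σ` the one for the remaining vectors. -/
theorem exists_parameters {ε : ℝ} (hε : 0 < ε) :
    ∃ (η K σ z : ℝ) (m W : ℕ), 0 < η ∧ η < 1 ∧ 0 < K ∧ (1 + η) / 2 ≤ σ ∧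
      1 / K + ((1 + η / 4) ^ m)⁻¹ + 12 / (12 + η ^ 2) ≤ σ ∧ 1 ≤ W ∧
      1 / K + ((1 + η / 4) ^ m)⁻¹ + 12 / (12 + η ^ 2 * W) ≤ (1 + η) / 2 ∧ 0 < z ∧ z ≤ 1 ∧
      2 * ((1 + η) / 2) ^ (1 + ε) < 1 ∧ (1 + z) * σ < 1 := by
  obtain ⟨η, hη, hη1, hηε⟩ : ∃ η : ℝ, 0 < η ∧ η < 1 ∧ 2 * ((1 + η) / 2) ^ (1 + ε) < 1 := by
    have hc : Tendsto (fun η : ℝ => 2 * ((1 + η) / 2) ^ (1 + ε)) (𝓝[>] 0)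
        (𝓝 (2 * ((1 + 0) / 2) ^ (1 + ε))) := by
      refine Tendsto.mono_left (Continuous.tendsto ?_ 0) nhdsWithin_le_nhds
      exact continuous_const.mul (Continuous.rpow_const (by fun_prop) fun _ => Or.inr (by linarith))
    have h0 : 2 * ((1 + 0) / 2 : ℝ) ^ (1 + ε) < 1 := by
      rw [Real.rpow_add (by norm_num), Real.rpow_one]
      have : ((1 + 0) / 2 : ℝ) ^ ε < 1 := Real.rpow_lt_one (by norm_num) (by norm_num) hε
      linarith
    obtain ⟨η, h1, h2, h3⟩ := ((hc.eventually (gt_mem_nhds h0)).and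
      (Ioo_mem_nhdsGT (zero_lt_one' ℝ))).exists
    exact ⟨η, h2, h3, h1⟩
  set c := 1 - 12 / (12 + η ^ 2) with hc
  have hc0 : 0 < c := by
    rw [hc, sub_pos, div_lt_one (by positivity)]
    have := sq_pos_of_pos hη
    linarith
  set q := min (c / 3) (1 / 8) with hq
  have hq0 : 0 < q := by positivity
  have hq1 : q ≤ c / 3 := min_le_left _ _
  have hq2 : q ≤ 1 / 8 := min_le_right _ _
  -- `1 / K = q`, and `m`, `W` make the other two terms small: for weights at least `W` the three
  -- terms add up to at most `1 / 8 + 1 / 8 + 1 / 4 = 1 / 2`, and in general to at most `1 - c / 3`.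
  obtain ⟨m, hm⟩ := exists_pow_lt_of_lt_one hq0
    (inv_lt_one_of_one_lt₀ (show 1 < 1 + η / 4 by linarith))
  rw [inv_pow] at hm
  obtain ⟨W, hW⟩ := exists_nat_ge (36 / η ^ 2)
  have hW0 : 0 < (W : ℝ) := lt_of_lt_of_le (by positivity) hW
  have hWq : 12 / (12 + η ^ 2 * W) ≤ 1 / 4 := by
    rw [div_le_iff₀ (by positivity)]
    rw [div_le_iff₀ (by positivity)] at hW
    linarith
  set σ := max ((1 + η) / 2) (1 - c / 3) with hσ
  have hσ1 : σ < 1 := max_lt (by linarith) (by linarith)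
  have hσ2 : (1 + η) / 2 ≤ σ := le_max_left _ _
  have hσ3 : 1 - c / 3 ≤ σ := le_max_right _ _
  refine ⟨η, 1 / q, σ, (1 - σ) / 2, m, W, hη, hη1, by positivity, hσ2, ?_,
    by exact_mod_cast hW0, ?_, by linarith, by linarith, hηε, by nlinarith⟩
  · rw [one_div_one_div]
    linarith
  · rw [one_div_one_div]
    linarith

/-- If `k / log n → ∞`, then `ρ ^ k` decays faster than any power of `n`. -/
theorem eventually_pow_le {k : ℕ → ℕ}
    (hk : Tendsto (fun n : ℕ => (k n : ℝ) / Real.log n) atTop atTop) {ρ : ℝ} (hρ : 0 < ρ)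
    (hρ1 : ρ < 1) (b : ℝ) : ∀ᶠ n : ℕ in atTop, ρ ^ k n ≤ (n : ℝ) ^ (-b) := by
  have hL : 0 < -Real.log ρ := neg_pos.2 (Real.log_neg hρ hρ1)
  filter_upwards [hk.eventually_ge_atTop (b / -Real.log ρ), eventually_gt_atTop 1] with n hn hn1
  have hn1' : (1 : ℝ) < n := by exact_mod_cast hn1
  rw [le_div_iff₀ (Real.log_pos hn1'), div_mul_eq_mul_div, div_le_iff₀ hL] at hn
  rw [← Real.rpow_natCast, Real.rpow_def_of_pos hρ, Real.rpow_def_of_pos (by linarith)]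
  refine Real.exp_le_exp.2 ?_
  linarith

/-- The polynomial prefactor of the union bound is absorbed by the exponential decay in `k`. -/
theorem eventually_union_bound_le {k : ℕ → ℕ}
    (hk : Tendsto (fun n : ℕ => (k n : ℝ) / Real.log n) atTop atTop) {ε η K σ z : ℝ} {m W : ℕ}
    (hε : 0 < ε) (hη : 0 < η) (hη1 : η < 1) (hK : 0 < K) (hσ : 0 < σ) (hz : 0 < z)
    (h1 : 2 * ((1 + η) / 2) ^ (1 + ε) < 1) (h2 : (1 + z) * σ < 1) (a : ℝ) :
    ∀ᶠ n : ℕ in atTop, ∀ t : ℕ, (1 + ε) * (k n : ℝ) ≤ t →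
      n * ((1 + K * (n : ℝ) ^ m) *
        (2 ^ k n * ((1 + η) / 2) ^ t + (z ^ W)⁻¹ * ((1 + z) ^ k n * σ ^ t))) ≤ (n : ℝ) ^ (-a) := by
  set ρ := max (2 * ((1 + η) / 2) ^ (1 + ε)) ((1 + z) * σ)
  have hρ : 0 < ρ := lt_max_of_lt_right (by positivity)
  have hρ1 : ρ < 1 := max_lt h1 h2
  have hσ1 : σ < 1 := lt_of_le_of_lt (le_mul_of_one_le_left hσ.le (by linarith)) h2
  set C := (1 + K) * (1 + (z ^ W)⁻¹) with hC
  filter_upwards [eventually_pow_le hk hρ hρ1 (a + m + 2), eventually_ge_atTop 1,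
    eventually_ge_atTop ⌈C⌉₊] with n hn hn1 hnC t ht
  have hn1' : (1 : ℝ) ≤ n := by exact_mod_cast hn1
  have hkt : k n ≤ t := by
    have : (k n : ℝ) ≤ t := le_trans (le_mul_of_one_le_left (by positivity) (by linarith)) ht
    exact_mod_cast this
  have e1 : 2 ^ k n * ((1 + η) / 2) ^ t ≤ ρ ^ k n := by
    calc 2 ^ k n * ((1 + η) / 2) ^ t ≤ 2 ^ k n * ((1 + η) / 2) ^ ((1 + ε) * k n : ℝ) := by
          gcongr
          rw [← Real.rpow_natCast]
          exact Real.rpow_le_rpow_of_exponent_ge (by linarith) (by linarith) ht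
      _ = (2 * ((1 + η) / 2) ^ (1 + ε)) ^ k n := by
          rw [Real.rpow_mul (by linarith), Real.rpow_natCast, mul_pow]
      _ ≤ ρ ^ k n := by
          gcongr
          exact le_max_left _ _
  have e2 : (1 + z) ^ k n * σ ^ t ≤ ρ ^ k n := by
    calc (1 + z) ^ k n * σ ^ t ≤ (1 + z) ^ k n * σ ^ k n := by
          gcongr ?_ * ?_
          exact pow_le_pow_of_le_one hσ.le hσ1.le hkt
      _ = ((1 + z) * σ) ^ k n := (mul_pow _ _ _).symm
      _ ≤ ρ ^ k n := by
          gcongr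
          exact le_max_right _ _
  calc _ ≤ n * (((1 + K) * (n : ℝ) ^ m) * (ρ ^ k n + (z ^ W)⁻¹ * ρ ^ k n)) := by
        gcongr
        rw [add_mul, one_mul]
        gcongr
        exact one_le_pow₀ hn1'
    _ = C * (n : ℝ) ^ (m + 1) * ρ ^ k n := by rw [hC]; ring
    _ ≤ n * (n : ℝ) ^ (m + 1) * (n : ℝ) ^ (-(a + m + 2)) := by
        gcongr
        exact (Nat.le_ceil C).trans (by exact_mod_cast hnC)
    _ = (n : ℝ) ^ (-a) := by
        rw [← pow_succ', ← Real.rpow_natCast, ← Real.rpow_add (by linarith)]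
        congr 1
        push_cast
        ring

end RLNC

theorem lemma9 (k : ℕ → ℕ)
    (hk : Tendsto (fun n : ℕ => (k n : ℝ) / Real.log n) atTop atTop)
    (ε : ℝ) (hε : 0 < ε) (a : ℝ) (ha : 0 < a) :
    ∀ᶠ n : ℕ in atTop, ∀ (V : Type) [Fintype V] [Nontrivial V], Fintype.card V = n →
      ∀ init : Fin (k n) → V, Function.Injective init →
        ∀ t : ℕ, (1 + ε) * (k n : ℝ) ≤ (t : ℝ) →
          1 - (n : ℝ) ^ (-a) ≤ RLNC.probFinished (ZMod 2) init t := by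
  obtain ⟨η, K, σ, z, m, W, hη, hη1, hK, hσ, hσ', hW, hW', hz, hz1, h1, h2⟩ :=
    RLNC.exists_parameters hε
  have hσ0 : 0 < σ := by linarith
  filter_upwards [RLNC.eventually_union_bound_le (m := m) (W := W) hk hε hη hη1 hK hσ0 hz h1 h2 a]
    with n hn V _ _ hV init hinit t ht
  have h := RLNC.one_sub_le_probFinished hη hη1 hK hσ hσ' hW hW' hz hz1 hinit t
  rw [hV] at h
  linarith [hn t ht]
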